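/- Let $\Sigma=\{0,1\}$ and let $|x|$ denote the length of $x\in\Sigma^*$. Polynomial time refers to deterministic Turing machines, FP is the set of total polynomial-time computable functions, and $\langle\cdot,\cdot\rangle:\Sigma^*\times\Sigma^*\to\Sigma^*$ is any total polynomial-time computable bijection with polynomial-time computable inverses. For a (possibly partial, possibly many-to-one) function $\sigma:\Sigma^*\times\Sigma^*\to\Sigma^*$, say that: - $\sigma$ is *one-way* if it is (i) honest: there is a polynomial $q$ such that every $z\in\mathrm{image}(\sigma)$ has some $(a,b)\in\mathrm{domain}(\sigma)$ with $|a|+|b|\le q(|z|)$ and $\sigma(a,b)=z$; (ii) polynomial-time computable; and (iii) noninvertible: there is no $g:\Sigma^*\to\Sigma^*\times\Sigma^*$ in FP such that $\sigma(g(z))=z$ for all $z\in\mathrm{image}(\sigma)$. - $\sigma$ is *s-honest* if there is a polynomial $q$ such that (a) for all $z,a$ for which some $b$ satisfies $\sigma(a,b)=z$, there is $b'$ with $|b'|\le q(|z|+|a|)$ and $\sigma(a,b')=z$; and (b) for all $z,b$ for which some $a$ satisfies $\sigma(a,b)=z$, there is $a'$ with $|a'|\le q(|z|+|b|)$ and $\sigma(a',b)=z$.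 - $\sigma$ is *invertible with respect to the first argument* if there is $g_1:\Sigma^*\to\Sigma^*$ in FP such that $\sigma(a,g_1(\langle a,z\rangle))=z$ whenever $\sigma(a,b)=z$; it is *invertible with respect to the second argument* if there is $g_2:\Sigma^*\to\Sigma^*$ in FP such that $\sigma(g_2(\langle b,z\rangle),b)=z$ whenever $\sigma(a,b)=z$. - $\sigma$ is *strongly one-way* if it is s-honest, polynomial-time computable, and invertible neither with respect to the first argument nor with respect to the second argument. If $\mathrm{P}\neq\mathrm{NP}$, then there exists a total, s-honest one-way function $\sigma:\Sigma^*\times\Sigma^*\to\Sigma^*$ that is not strongly one-way. -/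

import Mathlib

open Turing Computability

namespace OneWay

/-- Strings over the binary alphabet `Σ = {0,1}`; `x.length` is the length `|x|`. -/
abbrev Str : Type := List Bool

/-- The input/output word `a#b` representing a pair of strings, over the alphabet
`{0,1,#}` (`#` is `none`). -/
def encodePair (p : Str × Str) : List (Option Bool) :=
  p.1.map some ++ none :: p.2.map some

/-- The output word of a machine computing a possibly undefined string value:
the empty word for "undefined", and `1w` for the value `w`. -/
def encodePartial : Option Str → Str
  | none => []
  | some w => true :: w

/-- `f` is computed in polynomial time by a (multi-stack) Turing machine, where inputs are
written by `ea` and outputs by `eb`. The time is measured in the length of the written input.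
(Such a machine has finitely many stacks, labels and internal states, so it can write only
finitely many different symbols on each stack.) -/
def PolyTime {α β αΓ βΓ : Type} (ea : α → List αΓ) (eb : β → List βΓ) (f : α → β) : Prop :=
  Nonempty (TM2ComputableInPolyTime ea eb f)

/-- `FP` for total functions from strings to strings. -/
def FP (f : Str → Str) : Prop := PolyTime id id f

/-- `FP` for total functions from strings to pairs of strings. -/
def FPToPair (g : Str → Str × Str) : Prop := PolyTime id encodePair g

/-- `FP` for total functions from pairs of strings to strings. -/
def FPOfPair (h : Str → Str → Str) : Prop :=
  PolyTime encodePair id (fun p : Str × Str => h p.1 p.2)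

/-- The class `P` of languages over `{0,1}` that are decided in polynomial time. -/
def P : Set (Set Str) :=
  {L | ∃ f : Str → Bool, PolyTime id encodeBool f ∧ ∀ x, x ∈ L ↔ f x = true}

/-- The class `NP` of languages over `{0,1}`: membership is witnessed by certificates of
polynomially bounded length that are checked in polynomial time. -/
def NP : Set (Set Str) :=
  {L | ∃ (V : Str × Str → Bool) (p : Polynomial ℕ), PolyTime encodePair encodeBool V ∧
    ∀ x, x ∈ L ↔ ∃ w : Str, w.length ≤ p.eval x.length ∧ V (x, w) = true}

/-- A pairing function: a total polynomial-time computable bijection from pairs of strings to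
strings with polynomial-time computable inverses. (Monotonicity in each argument, which is often
also asked of a standard pairing function, is not required.) -/
structure IsPairing (pair : Str → Str → Str) : Prop where
  bijective : Function.Bijective (fun p : Str × Str => pair p.1 p.2)
  polyTime : FPOfPair pair
  inverses : ∃ π₁ π₂ : Str → Str, FP π₁ ∧ FP π₂ ∧
    ∀ a b, π₁ (pair a b) = a ∧ π₂ (pair a b) = b

/-- Possibly nontotal, possibly many-to-one 2-ary functions on strings;
`ρ a b = none` means that `(a, b)` is not in the domain of `ρ`. -/
abbrev Fun2 : Type := Str → Str → Option Str

/-- The domain of `ρ` is everything. -/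
def Total (ρ : Fun2) : Prop := ∀ a b, ∃ z, ρ a b = some z

/-- The image of `ρ`. -/
def image (ρ : Fun2) : Set Str := {z | ∃ a b, ρ a b = some z}

/-- Polynomial-time computability of a possibly nontotal 2-ary function: a polynomial-time
machine outputs the value where there is one, and reports that there is none otherwise. -/
def PolyTimeComputable (ρ : Fun2) : Prop :=
  PolyTime encodePair encodePartial (fun p : Str × Str => ρ p.1 p.2)

/-- Honesty. -/
def Honest (ρ : Fun2) : Prop :=
  ∃ q : Polynomial ℕ, ∀ z ∈ image ρ, ∃ a b,
    a.length + b.length ≤ q.eval z.length ∧ ρ a b = some z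

/-- (Polynomial-time) noninvertibility. -/
def Noninvertible (ρ : Fun2) : Prop :=
  ¬ ∃ g : Str → Str × Str, FPToPair g ∧ ∀ z ∈ image ρ, ρ (g z).1 (g z).2 = some z

/-- One-way 2-ary functions. -/
def IsOneWay (ρ : Fun2) : Prop :=
  Honest ρ ∧ PolyTimeComputable ρ ∧ Noninvertible ρ

/-- s-honesty. -/
def SHonest (σ : Fun2) : Prop :=
  ∃ q : Polynomial ℕ,
    (∀ z a, (∃ b, σ a b = some z) →
      ∃ b', b'.length ≤ q.eval (z.length + a.length) ∧ σ a b' = some z) ∧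
    (∀ z b, (∃ a, σ a b = some z) →
      ∃ a', a'.length ≤ q.eval (z.length + b.length) ∧ σ a' b = some z)

/-- (Polynomial-time) invertibility with respect to the first argument. -/
def InvertibleFst (pair : Str → Str → Str) (σ : Fun2) : Prop :=
  ∃ g₁ : Str → Str, FP g₁ ∧ ∀ z ∈ image σ, ∀ a b, σ a b = some z →
    σ a (g₁ (pair a z)) = some z

/-- (Polynomial-time) invertibility with respect to the second argument. -/
def InvertibleSnd (pair : Str → Str → Str) (σ : Fun2) : Prop :=
  ∃ g₂ : Str → Str, FP g₂ ∧ ∀ z ∈ image σ, ∀ a b, σ a b = some z →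
    σ (g₂ (pair b z)) b = some z

/-- Strong noninvertibility. -/
def StronglyNoninvertible (pair : Str → Str → Str) (σ : Fun2) : Prop :=
  ¬ InvertibleFst pair σ ∧ ¬ InvertibleSnd pair σ

/-- Strongly one-way 2-ary functions. -/
def IsStronglyOneWay (pair : Str → Str → Str) (σ : Fun2) : Prop :=
  SHonest σ ∧ PolyTimeComputable σ ∧ StronglyNoninvertible pair σ

end OneWay

/-! Fix a language `L` in NP but not in P, with verifier `V` and certificate bound `p`, and let σ(a,
b) = cb, where the bit c tells whether `a` is a certificate for `b` of length at most p(|b|). This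
function is `certify`. The value displays the second argument, so dropping its first bit inverts σ
with respect to the first argument, and σ is not strongly one-way (`invertibleFst_certify`).
Inverting σ itself is hard: a preimage of 1x contains a certificate for x whenever one exists, and
checking the inverter's answer would decide `L` (`noninvertible_certify`). Honesty and s-honesty are
cheap: overlong strings are all rejected, so one of length p(|b|) + 1 can replace them all
(`exists_length_le_boundedVerifier`).

The bulk of the work is to show that these functions run in polynomial time on actual multi-stack
machines. Three closure principles carry this: finite-state transductions (`PolyTime.of_transduce`),
composition (`PolyTime.comp`) and pairing of two functions of one input (`PolyTime.prodMk`). Testing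
|a| ≤ p(|b|) also needs unary multiplication and comparison, for which there are explicit machines.
The compound machines rest on two simulation lemmas, `Steps.embed` for running a submachine and
`Steps.move` for transporting a word. -/

namespace OneWay

/-! ### Runs with an exact step count -/

section Steps

variable {K : Type} [DecidableEq K] {Γ : K → Type} {Λ σ : Type}

/-- `Steps M n c d` says that the machine `M` goes from `c` to `d` in exactly `n` steps. -/
inductive Steps (M : Λ → TM2.Stmt Γ Λ σ) : ℕ → TM2.Cfg Γ Λ σ → TM2.Cfg Γ Λ σ → Prop
  | refl (c) : Steps M 0 c c
  | head {n c d e} : TM2.step M c = some d → Steps M n d e → Steps M (n + 1) c e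

variable {M : Λ → TM2.Stmt Γ Λ σ}

theorem Steps.trans {n m : ℕ} {c d e : TM2.Cfg Γ Λ σ} (h₁ : Steps M n c d)
    (h₂ : Steps M m d e) : Steps M (n + m) c e := by
  induction h₁ with
  | refl => simpa using h₂
  | head h _ ih =>
    rw [Nat.add_right_comm]
    exact .head h (ih h₂)

theorem Steps.one {l : Λ} {v : σ} {S : ∀ k, List (Γ k)} {d : TM2.Cfg Γ Λ σ}
    (h : TM2.stepAux (M l) v S = d) : Steps M 1 ⟨some l, v, S⟩ d :=
  .head (by simp [h]) (.refl _)

theorem Steps.cons {n m : ℕ} {l : Λ} {v : σ} {S : ∀ k, List (Γ k)} {d e : TM2.Cfg Γ Λ σ}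
    (h₁ : TM2.stepAux (M l) v S = d) (h₂ : Steps M n d e) (hm : n + 1 = m) :
    Steps M m ⟨some l, v, S⟩ e :=
  hm ▸ .head (by simp [h₁]) h₂

theorem iterate_bind_none {α : Type} (f : α → Option α) (n : ℕ) :
    (flip bind f)^[n] (none : Option α) = none := by
  induction n with
  | zero => rfl
  | succ n ih => rw [Function.iterate_succ_apply]; exact ih

/-- Bridge to Mathlib's formulation by iterated partial steps. In the converse direction, a run that
stops early stays at `none` and so cannot reach `some d`. -/
theorem steps_iff {n : ℕ} {c d : TM2.Cfg Γ Λ σ} :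
    Steps M n c d ↔ (flip bind (TM2.step M))^[n] (some c) = some d := by
  constructor
  · intro h
    induction h with
    | refl => rfl
    | head h _ ih =>
      rw [Function.iterate_succ_apply, ← ih, ← h]; rfl
  · induction n generalizing c with
    | zero =>
      intro h
      obtain rfl : c = d := by simpa using h
      exact .refl _
    | succ n ih =>
      rw [Function.iterate_succ_apply]
      intro h
      cases hc : TM2.step M c with
      | none =>
        have : flip bind (TM2.step M) (some c) = none := hc
        rw [this, iterate_bind_none] at h
        cases h
      | some e =>
        have : flip bind (TM2.step M) (some c) = some e := hc
        rw [this] at h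
        exact .head hc (ih h)

end Steps

/-! ### Polynomial-time machines in terms of `Steps` -/

theorem initList_eq (tm : FinTM2) (s : List (tm.Γ tm.k₀)) :
    initList tm s =
      ⟨some tm.main, tm.initialState, Function.update (fun _ => []) tm.k₀ s⟩ := by
  unfold initList
  congr 1
  funext k
  by_cases h : k = tm.k₀
  · subst h; simp
  · simp [h]

/-- A proper halt requires the initial internal state and empty stacks apart from the output. This
is why the machines below drain their work stacks and reset their registers. -/
theorem haltList_eq (tm : FinTM2) (s : List (tm.Γ tm.k₁)) :
    haltList tm s = ⟨none, tm.initialState, Function.update (fun _ => []) tm.k₁ s⟩ := by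
  unfold haltList
  congr 1
  funext k
  by_cases h : k = tm.k₁
  · subst h; simp
  · simp [h]

/-- The machine `M` transforms the input word `x` on stack `k₀` to the output word `y` on stack
`k₁` in at most `t` steps. -/
def Transforms {K : Type} [DecidableEq K] {Γ : K → Type} {Λ σ : Type}
    (M : Λ → TM2.Stmt Γ Λ σ) (k₀ k₁ : K) (main : Λ) (s : σ)
    (x : List (Γ k₀)) (y : List (Γ k₁)) (t : ℕ) : Prop :=
  ∃ n ≤ t, Steps M n ⟨some main, s, Function.update (fun _ => []) k₀ x⟩
    ⟨none, s, Function.update (fun _ => []) k₁ y⟩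

theorem polyTime_of_transforms {α β αΓ βΓ : Type} {ea : α → List αΓ} {eb : β → List βΓ}
    {f : α → β} {K : Type} [DecidableEq K] [Fintype K] {Γ : K → Type} {Λ σ : Type} [Fintype Λ]
    [Fintype σ] (M : Λ → TM2.Stmt Γ Λ σ) (k₀ k₁ : K) [Fintype (Γ k₀)] (main : Λ) (s : σ)
    (e₀ : Γ k₀ ≃ αΓ) (e₁ : Γ k₁ ≃ βΓ) (p : Polynomial ℕ)
    (h : ∀ a, Transforms M k₀ k₁ main s ((ea a).map e₀.symm) ((eb (f a)).map e₁.symm)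
      (p.eval (ea a).length)) :
    PolyTime ea eb f := by
  refine ⟨⟨⟨⟨k₀, k₁, Γ, Λ, main, σ, s, M⟩, e₀, e₁⟩, p, fun a => Classical.choice ?_⟩⟩
  obtain ⟨n, hn, hs⟩ := h a
  refine ⟨⟨⟨n, ?_⟩, hn⟩⟩
  rw [initList_eq, Option.map_some, haltList_eq]
  exact steps_iff.1 hs

theorem PolyTime.exists_transforms {α β αΓ βΓ : Type} {ea : α → List αΓ} {eb : β → List βΓ}
    {f : α → β} (h : PolyTime ea eb f) :
    ∃ (tm : FinTM2) (e₀ : tm.Γ tm.k₀ ≃ αΓ) (e₁ : tm.Γ tm.k₁ ≃ βΓ) (p : Polynomial ℕ),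
      ∀ a, Transforms tm.m tm.k₀ tm.k₁ tm.main tm.initialState ((ea a).map e₀.symm)
        ((eb (f a)).map e₁.symm) (p.eval (ea a).length) := by
  obtain ⟨⟨⟨tm, e₀, e₁⟩, p, h⟩⟩ := h
  refine ⟨tm, e₀, e₁, p, fun a => ?_⟩
  obtain ⟨⟨n, hs⟩, hn⟩ := h a
  refine ⟨n, hn, ?_⟩
  rw [initList_eq, Option.map_some, haltList_eq] at hs
  exact steps_iff.2 hs

/-! ### Growth of the stacks -/

section Growth

variable {K : Type} [DecidableEq K] {Γ : K → Type} {Λ σ : Type}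

/-- An upper bound on the number of symbols that a statement pushes. -/
def pushCount : TM2.Stmt Γ Λ σ → ℕ
  | .push _ _ q => pushCount q + 1
  | .peek _ _ q => pushCount q
  | .pop _ _ q => pushCount q
  | .load _ q => pushCount q
  | .branch _ q₁ q₂ => pushCount q₁ + pushCount q₂
  | .goto _ => 0
  | .halt => 0

/-- A statement has no loops, so each of its pushes is executed at most once per step. -/
theorem length_stepAux_le (q : TM2.Stmt Γ Λ σ) (v : σ) (S : ∀ k, List (Γ k)) (k : K) :
    ((TM2.stepAux q v S).stk k).length ≤ (S k).length + pushCount q := by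
  induction q generalizing v S with
  | push k' f q ih =>
    refine (ih _ _).trans ?_
    by_cases h : k = k'
    · subst h; simp [pushCount]; omega
    · simp [pushCount, h]
  | peek k' f q ih => exact ih _ _
  | pop k' f q ih =>
    refine (ih _ _).trans ?_
    by_cases h : k = k'
    · subst h; simp [pushCount]
    · simp [pushCount, h]
  | load f q ih => exact ih _ _
  | branch f q₁ q₂ ih₁ ih₂ =>
    simp only [TM2.stepAux, pushCount]
    cases f v
    · exact (ih₂ _ _).trans (by omega)
    · exact (ih₁ _ _).trans (by omega)
  | goto => simp [pushCount]
  | halt => simp [pushCount]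

theorem Steps.length_le {M : Λ → TM2.Stmt Γ Λ σ} {C : ℕ} (hC : ∀ l, pushCount (M l) ≤ C)
    {n : ℕ} {c d : TM2.Cfg Γ Λ σ} (h : Steps M n c d) (k : K) :
    (d.stk k).length ≤ (c.stk k).length + C * n := by
  induction h with
  | refl => simp
  | @head n c d e h _ ih =>
    obtain ⟨l, v, S⟩ := c
    cases l with
    | none => simp at h
    | some l =>
      simp only [TM2.step, Option.some.injEq] at h
      have h1 := length_stepAux_le (M l) v S k
      rw [h] at h1
      have h2 := hC l
      simp only [mul_add, mul_one]
      omega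

theorem exists_pushCount_le {K : Type} {Γ : K → Type} {Λ σ : Type} [Finite Λ]
    (M : Λ → TM2.Stmt Γ Λ σ) : ∃ C, ∀ l, pushCount (M l) ≤ C := by
  obtain ⟨C, hC⟩ := (Set.finite_range fun l => pushCount (M l)).bddAbove
  exact ⟨C, fun l => hC ⟨l, rfl⟩⟩

/-- With finitely many labels, one constant bounds the pushes per step, so time bounds output
length. Composition needs this to control the input length of the second machine. -/
theorem exists_length_output_le [Finite Λ] (M : Λ → TM2.Stmt Γ Λ σ) (k₀ k₁ : K) (main : Λ) (s : σ) :
    ∃ C, ∀ x y t, Transforms M k₀ k₁ main s x y t → y.length ≤ x.length + C * t := by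
  obtain ⟨C, hC⟩ := exists_pushCount_le M
  refine ⟨C, fun x y t ⟨n, hn, h⟩ => ?_⟩
  have := h.length_le hC k₁
  have h2 : (Function.update (fun _ => []) k₀ x k₁ : List (Γ k₁)).length ≤ x.length := by
    by_cases h : k₁ = k₀
    · subst h; simp
    · simp [h]
  have h3 : C * n ≤ C * t := Nat.mul_le_mul_left _ hn
  simp only [Function.update_self] at this
  omega

end Growth

/-! ### Running a machine inside a larger one -/

section Embed

variable {K K' : Type} [DecidableEq K] [DecidableEq K'] {Γ : K → Type} {Γ' : K' → Type}
  {Λ Λ' σ V : Type}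

/-- The statement `q` of a machine, executed within a larger machine: stacks are renamed by `ι`,
labels by `lab`, and halting is replaced by a jump to `cont`. -/
def embedStmt (ι : K → K') (e : ∀ k, Γ' (ι k) ≃ Γ k) (get : V → σ) (set : V → σ → V)
    (lab : Λ → Λ') (cont : Λ') : TM2.Stmt Γ Λ σ → TM2.Stmt Γ' Λ' V
  | .push k f q => .push (ι k) (fun v => (e k).symm (f (get v)))
      (embedStmt ι e get set lab cont q)
  | .peek k f q => .peek (ι k) (fun v x => set v (f (get v) (x.map (e k))))
      (embedStmt ι e get set lab cont q)
  | .pop k f q => .pop (ι k) (fun v x => set v (f (get v) (x.map (e k))))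
      (embedStmt ι e get set lab cont q)
  | .load f q => .load (fun v => set v (f (get v))) (embedStmt ι e get set lab cont q)
  | .branch f q₁ q₂ => .branch (fun v => f (get v)) (embedStmt ι e get set lab cont q₁)
      (embedStmt ι e get set lab cont q₂)
  | .goto f => .goto fun v => lab (f (get v))
  | .halt => .goto fun _ => cont

variable {ι : K → K'} {e : ∀ k, Γ' (ι k) ≃ Γ k} {get : V → σ} {set : V → σ → V}
  {lab : Λ → Λ'} {cont : Λ'} {mkV : σ → V} {mkS : (∀ k, List (Γ k)) → ∀ k, List (Γ' k)}

/-- `mkV` and `mkS` insert the state and stacks of the small machine into a frozen environment; the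
hypotheses say that reads and writes through `get`, `set` and `ι` respect this insertion. -/
theorem stepAux_embedStmt (hget : ∀ s, get (mkV s) = s) (hset : ∀ s s', set (mkV s) s' = mkV s')
    (hS : ∀ S k, mkS S (ι k) = (S k).map (e k).symm)
    (hupd : ∀ S k l, Function.update (mkS S) (ι k) (l.map (e k).symm) =
      mkS (Function.update S k l))
    (q : TM2.Stmt Γ Λ σ) (s : σ) (S : ∀ k, List (Γ k)) :
    TM2.stepAux (embedStmt ι e get set lab cont q) (mkV s) (mkS S) =
      ⟨some ((TM2.stepAux q s S).l.elim cont lab), mkV (TM2.stepAux q s S).var,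
        mkS (TM2.stepAux q s S).stk⟩ := by
  have hhead : ∀ (S : ∀ k, List (Γ k)) (k : K),
      ((mkS S (ι k)).head?).map (e k) = (S k).head? := by
    intro S k; rw [hS]; cases S k <;> simp
  have htail : ∀ (S : ∀ k, List (Γ k)) (k : K),
      (mkS S (ι k)).tail = ((S k).tail).map (e k).symm := by
    intro S k; rw [hS]; cases S k <;> simp
  induction q generalizing s S with
  | push k f q ih =>
    simp only [embedStmt, TM2.stepAux, hget]
    rw [← ih, ← hupd, List.map_cons, hS]
  | peek k f q ih =>
    simp only [embedStmt, TM2.stepAux, hget, hset, hhead]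
    rw [← ih]
  | pop k f q ih =>
    simp only [embedStmt, TM2.stepAux, hget, hset, hhead, htail, hupd]
    rw [← ih]
  | load f q ih =>
    simp only [embedStmt, TM2.stepAux, hget, hset]
    rw [← ih]
  | branch f q₁ q₂ ih₁ ih₂ =>
    simp only [embedStmt, TM2.stepAux, hget]
    cases f s
    · simp [ih₂]
    · simp [ih₁]
  | goto f => simp [embedStmt, TM2.stepAux, hget]
  | halt => simp [embedStmt, TM2.stepAux]

/-- Halting is simulated by a jump to `cont` within the same step, so the step count is preserved
exactly. -/
theorem Steps.embed {M : Λ → TM2.Stmt Γ Λ σ} {M' : Λ' → TM2.Stmt Γ' Λ' V}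
    (hM : ∀ l, M' (lab l) = embedStmt ι e get set lab cont (M l))
    (hget : ∀ s, get (mkV s) = s) (hset : ∀ s s', set (mkV s) s' = mkV s')
    (hS : ∀ S k, mkS S (ι k) = (S k).map (e k).symm)
    (hupd : ∀ S k l, Function.update (mkS S) (ι k) (l.map (e k).symm) =
      mkS (Function.update S k l)) {n : ℕ} {c d : TM2.Cfg Γ Λ σ} (h : Steps M n c d) :
    Steps M' n ⟨some (c.l.elim cont lab), mkV c.var, mkS c.stk⟩
      ⟨some (d.l.elim cont lab), mkV d.var, mkS d.stk⟩ := by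
  induction h with
  | refl => exact .refl _
  | @head n c d e h _ ih =>
    obtain ⟨l, v, S⟩ := c
    cases l with
    | none => simp at h
    | some l =>
      simp only [TM2.step, Option.some.injEq] at h
      refine .head ?_ ih
      simp only [Option.elim, TM2.step, hM, Option.some.injEq]
      rw [stepAux_embedStmt hget hset hS hupd, h]
      rfl

end Embed

/-! ### Moving the contents of a stack -/

section Move

variable {K : Type} [DecidableEq K] {Γ : K → Type} {Λ V B : Type}

/-- Pop all symbols of the stack `a`, push them on the stack `b`, and go to `nxt`. -/
def moveStmt (a b : K) (f : Γ a → B) (g : Option B → Γ b) (get : V → Option B)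
    (put : V → Option B → V) (lbl nxt : Λ) : TM2.Stmt Γ Λ V :=
  .pop a (fun v x => put v (x.map f)) <|
    .branch (fun v => (get v).isSome)
      (.push b (fun v => g (get v)) (.goto fun _ => lbl))
      (.goto fun _ => nxt)

/-- The word arrives reversed, so order is restored by moving twice. The additional step is the pop
of the empty stack, which also leaves `none` in the register. -/
theorem Steps.move {M : Λ → TM2.Stmt Γ Λ V} {a b : K} {f : Γ a → B} {g : Option B → Γ b}
    {get : V → Option B} {put : V → Option B → V} {lbl nxt : Λ}
    (hM : M lbl = moveStmt a b f g get put lbl nxt) (hab : a ≠ b)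
    (hget : ∀ v x, get (put v x) = x) (hput : ∀ v x y, put (put v x) y = put v y)
    (v : V) (S : ∀ k, List (Γ k)) :
    Steps M ((S a).length + 1) ⟨some lbl, v, S⟩
      ⟨some nxt, put v none, Function.update (Function.update S a []) b
        (((S a).map fun x => g (some (f x))).reverse ++ S b)⟩ := by
  generalize hl : S a = l
  induction l generalizing v S with
  | nil =>
    apply Steps.one
    rw [hM]
    simp only [moveStmt, TM2.stepAux, hget, hl]
    simp only [List.head?_nil, Option.map_none, Option.isSome_none, cond_false, List.tail_nil]
    congr 1
    funext k
    by_cases h : k = b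
    · subst h; simp [hab.symm]
    · simp [h]
  | cons x l ih =>
    have h1 : Steps M 1 ⟨some lbl, v, S⟩ ⟨some lbl, put v (some (f x)),
        Function.update (Function.update S a l) b (g (some (f x)) :: S b)⟩ := by
      apply Steps.one
      rw [hM]
      simp [moveStmt, TM2.stepAux, hget, hl, hab.symm]
    have h2 := ih (put v (some (f x)))
      (Function.update (Function.update S a l) b (g (some (f x)) :: S b)) (by simp [hab])
    rw [hput] at h2
    rw [List.length_cons, Nat.add_comm _ 1]
    convert h1.trans h2 using 2
    funext k
    by_cases h : k = b
    · subst h; simp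
    · by_cases h' : k = a
      · subst h'; simp [h]
      · simp [h, h']

end Move

/-! ### Two disjoint families of stacks -/

section SumStk

variable {K₁ K₂ : Type} {Γ₁ : K₁ → Type} {Γ₂ : K₂ → Type}

/-- The stack alphabets of the disjoint union of two families of stacks. -/
abbrev SumAlph (Γ₁ : K₁ → Type) (Γ₂ : K₂ → Type) : K₁ ⊕ K₂ → Type
  | .inl k => Γ₁ k
  | .inr k => Γ₂ k

/-- The stack contents of the disjoint union of two families of stacks. -/
def sumStk (S : ∀ k, List (Γ₁ k)) (T : ∀ k, List (Γ₂ k)) : ∀ k, List (SumAlph Γ₁ Γ₂ k)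
  | .inl k => S k
  | .inr k => T k

@[simp] theorem sumStk_inl (S : ∀ k, List (Γ₁ k)) (T : ∀ k, List (Γ₂ k)) (k : K₁) :
    sumStk S T (.inl k) = S k := rfl

@[simp] theorem sumStk_inr (S : ∀ k, List (Γ₁ k)) (T : ∀ k, List (Γ₂ k)) (k : K₂) :
    sumStk S T (.inr k) = T k := rfl

@[simp] theorem update_sumStk_inl [DecidableEq K₁] [DecidableEq K₂] (S : ∀ k, List (Γ₁ k)) (T : ∀ k, List (Γ₂ k)) (k : K₁)
    (l : List (Γ₁ k)) :
    Function.update (sumStk S T) (.inl k) l = sumStk (Function.update S k l) T := by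
  funext j
  rcases j with j | j
  · by_cases h : j = k
    · subst h; simp
    · rw [Function.update_of_ne (by simpa using h), sumStk_inl, sumStk_inl,
        Function.update_of_ne h]
  · rw [Function.update_of_ne (by simp), sumStk_inr, sumStk_inr]

@[simp] theorem update_sumStk_inr [DecidableEq K₁] [DecidableEq K₂] (S : ∀ k, List (Γ₁ k)) (T : ∀ k, List (Γ₂ k)) (k : K₂)
    (l : List (Γ₂ k)) :
    Function.update (sumStk S T) (.inr k) l = sumStk S (Function.update T k l) := by
  funext j
  rcases j with j | j
  · rw [Function.update_of_ne (by simp), sumStk_inl, sumStk_inl]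
  · by_cases h : j = k
    · subst h; simp
    · rw [Function.update_of_ne (by simpa using h), sumStk_inr, sumStk_inr,
        Function.update_of_ne h]

theorem sumStk_nil : sumStk (fun k => ([] : List (Γ₁ k))) (fun k => ([] : List (Γ₂ k))) =
    fun _ => [] := by
  funext j; rcases j with j | j <;> rfl

end SumStk

/-! ### Output length and composition -/

theorem eval_mono_nat (p : Polynomial ℕ) {m n : ℕ} (h : m ≤ n) : p.eval m ≤ p.eval n := by
  simp only [Polynomial.eval_eq_sum_range]
  exact Finset.sum_le_sum fun i _ => Nat.mul_le_mul_left _ (Nat.pow_le_pow_left h i)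

theorem PolyTime.exists_length_le {α β αΓ βΓ : Type} {ea : α → List αΓ} {eb : β → List βΓ}
    {f : α → β} (h : PolyTime ea eb f) :
    ∃ p : Polynomial ℕ, ∀ a, (eb (f a)).length ≤ p.eval (ea a).length := by
  obtain ⟨tm, e₀, e₁, p, h⟩ := h.exists_transforms
  have := tm.ΛFin
  obtain ⟨C, hC⟩ := exists_length_output_le tm.m tm.k₀ tm.k₁ tm.main tm.initialState
  refine ⟨Polynomial.X + Polynomial.C C * p, fun a => ?_⟩
  simpa using hC _ _ _ (h a)

section Comp

variable (tm₁ tm₂ : FinTM2) (B : Type) [Inhabited B] (e₁ : tm₁.Γ tm₁.k₁ ≃ B)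
  (e₂ : tm₂.Γ tm₂.k₀ ≃ B)

/-- Run `tm₁`, transport its output to the input stack of `tm₂`, and run `tm₂`. -/
def compMachine : tm₁.Λ ⊕ tm₂.Λ ⊕ Fin 3 →
    TM2.Stmt (SumAlph tm₁.Γ (SumAlph tm₂.Γ fun _ : Unit => B)) (tm₁.Λ ⊕ tm₂.Λ ⊕ Fin 3)
      (tm₁.σ × tm₂.σ × Option B)
  | .inl l => embedStmt .inl (fun _ => Equiv.refl _) (fun v => v.1) (fun v s => (s, v.2)) .inl
      (.inr (.inr 0)) (tm₁.m l)
  | .inr (.inl l) => embedStmt (fun k => .inr (.inl k)) (fun _ => Equiv.refl _) (fun v => v.2.1)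
      (fun v s => (v.1, s, v.2.2)) (fun l => .inr (.inl l)) (.inr (.inr 2)) (tm₂.m l)
  | .inr (.inr 0) => moveStmt (Γ := SumAlph tm₁.Γ (SumAlph tm₂.Γ fun _ : Unit => B))
      (.inl tm₁.k₁) (.inr (.inr ())) e₁ (fun x => x.getD default)
      (fun v => v.2.2) (fun v x => (v.1, v.2.1, x)) (.inr (.inr 0)) (.inr (.inr 1))
  | .inr (.inr 1) => moveStmt (Γ := SumAlph tm₁.Γ (SumAlph tm₂.Γ fun _ : Unit => B))
      (.inr (.inr ())) (.inr (.inl tm₂.k₀)) id (fun x => e₂.symm (x.getD default))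
      (fun v => v.2.2) (fun v x => (v.1, v.2.1, x)) (.inr (.inr 1)) (.inr (.inl tm₂.main))
  | .inr (.inr 2) => .halt

/-- The intermediate word passes through the extra stack, one reversal on each side, at a cost of
`y.length + 1` per pass; the last step is the final halt. -/
theorem compMachine_transforms {x} {y : List B} {z} {t₁ t₂ : ℕ}
    (h₁ : Transforms tm₁.m tm₁.k₀ tm₁.k₁ tm₁.main tm₁.initialState x (y.map e₁.symm) t₁)
    (h₂ : Transforms tm₂.m tm₂.k₀ tm₂.k₁ tm₂.main tm₂.initialState (y.map e₂.symm) z t₂) :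
    Transforms (compMachine tm₁ tm₂ B e₁ e₂) (.inl tm₁.k₀) (.inr (.inl tm₂.k₁)) (.inl tm₁.main)
      (tm₁.initialState, tm₂.initialState, none) x z
      (t₁ + (y.length + 1) + (y.length + 1) + t₂ + 1) := by
  obtain ⟨n₁, hn₁, h₁⟩ := h₁
  obtain ⟨n₂, hn₂, h₂⟩ := h₂
  have r₁ := h₁.embed (M' := compMachine tm₁ tm₂ B e₁ e₂) (ι := Sum.inl)
    (e := fun _ => Equiv.refl _) (get := fun v => v.1) (set := fun v s => (s, v.2))
    (lab := Sum.inl) (cont := .inr (.inr 0)) (mkV := fun s => (s, tm₂.initialState, none))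
    (mkS := fun S => sumStk S (sumStk (fun _ => []) fun _ => []))
    (fun l => rfl) (fun _ => rfl) (fun _ _ => rfl) (by simp) (by simp)
  have r₂ := Steps.move (M := compMachine tm₁ tm₂ B e₁ e₂) (lbl := .inr (.inr 0))
    (a := .inl tm₁.k₁) (b := .inr (.inr ())) (f := e₁) (g := fun x => x.getD default)
    (get := fun v => v.2.2) (put := fun v x => (v.1, v.2.1, x)) (nxt := .inr (.inr 1)) rfl
    (by simp) (fun _ _ => rfl) (fun _ _ _ => rfl) (tm₁.initialState, tm₂.initialState, none)
    (sumStk (Function.update (fun _ => []) tm₁.k₁ (y.map e₁.symm))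
      (sumStk (fun _ => []) fun _ => []))
  have r₃ := Steps.move (M := compMachine tm₁ tm₂ B e₁ e₂) (lbl := .inr (.inr 1))
    (a := .inr (.inr ())) (b := .inr (.inl tm₂.k₀)) (f := id)
    (g := fun x => e₂.symm (x.getD default))
    (get := fun v => v.2.2) (put := fun v x => (v.1, v.2.1, x)) (nxt := .inr (.inl tm₂.main)) rfl
    (by simp) (fun _ _ => rfl) (fun _ _ _ => rfl) (tm₁.initialState, tm₂.initialState, none)
    (sumStk (fun _ => []) (sumStk (fun _ => []) (Function.update (fun _ => []) () y.reverse)))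
  have r₄ := h₂.embed (M' := compMachine tm₁ tm₂ B e₁ e₂) (ι := fun k => .inr (.inl k))
    (e := fun _ => Equiv.refl _) (get := fun v => v.2.1) (set := fun v s => (v.1, s, v.2.2))
    (lab := fun l => .inr (.inl l)) (cont := .inr (.inr 2))
    (mkV := fun s => (tm₁.initialState, s, none))
    (mkS := fun S => sumStk (fun _ => []) (sumStk S fun _ => []))
    (fun l => rfl) (fun _ => rfl) (fun _ _ => rfl) (by simp) (by simp)
  have r₅ := Steps.one (M := compMachine tm₁ tm₂ B e₁ e₂) (l := .inr (.inr 2))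
    (v := (tm₁.initialState, tm₂.initialState, none))
    (S := sumStk (fun _ => []) (sumStk (Function.update (fun _ => []) tm₂.k₁ z) fun _ => [])) rfl
  simp [Function.comp_def] at r₁ r₂ r₃ r₄ r₅
  refine ⟨n₁ + (y.length + 1) + (y.length + 1) + n₂ + 1, by omega, ?_⟩
  rw [← sumStk_nil, ← sumStk_nil, update_sumStk_inl, update_sumStk_inr, update_sumStk_inl]
  exact (((r₁.trans r₂).trans r₃).trans r₄).trans r₅

end Comp

theorem PolyTime.comp {α β γ αΓ βΓ γΓ : Type} [Inhabited βΓ] {ea : α → List αΓ}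
    {eb : β → List βΓ} {ec : γ → List γΓ} {g : β → γ} {f : α → β}
    (hg : PolyTime eb ec g) (hf : PolyTime ea eb f) : PolyTime ea ec (fun a => g (f a)) := by
  obtain ⟨q, hq⟩ := hf.exists_length_le
  obtain ⟨tm₁, e₀, e₁, p₁, h₁⟩ := hf.exists_transforms
  obtain ⟨tm₂, e₂, e₃, p₂, h₂⟩ := hg.exists_transforms
  let _ := tm₁.kFin
  let _ := tm₂.kFin
  let _ := tm₁.ΛFin
  let _ := tm₂.ΛFin
  let _ := tm₁.σFin
  let _ := tm₂.σFin
  let _ := tm₁.Γk₀Fin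
  let _ := tm₂.Γk₀Fin
  -- The internal state includes a register of type `Option βΓ`. Its finiteness comes from the input
  -- alphabet of the second machine.
  let _ : Fintype βΓ := Fintype.ofEquiv _ e₂
  refine polyTime_of_transforms (compMachine tm₁ tm₂ βΓ e₁ e₂) (.inl tm₁.k₀) (.inr (.inl tm₂.k₁))
    (.inl tm₁.main) (tm₁.initialState, tm₂.initialState, none) e₀ e₃
    (p₁ + (q + 1) + (q + 1) + p₂.comp q + 1) fun a => ?_
  obtain ⟨n, hn, h⟩ := compMachine_transforms tm₁ tm₂ βΓ e₁ e₂ (h₁ a) (h₂ (f a))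
  refine ⟨n, hn.trans ?_, h⟩
  have := hq a
  have := eval_mono_nat p₂ this
  simp only [Polynomial.eval_add, Polynomial.eval_comp, Polynomial.eval_one]
  omega

/-! ### Two machines on the same input -/

/-- The stacks of `prodMachine` that belong to neither of its submachines. -/
inductive ProdStack
  | input
  | copy
  | rev
  | output
  deriving DecidableEq

/-- The phases of `prodMachine` that belong to neither of its submachines. -/
inductive ProdPhase
  | start
  | duplicate
  | pop₂
  | push₂
  | pop₁
  | push₁
  | done
  deriving DecidableEq

instance : Fintype ProdStack :=
  ⟨{.input, .copy, .rev, .output}, fun x => by cases x <;> simp⟩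

instance : Fintype ProdPhase :=
  ⟨{.start, .duplicate, .pop₂, .push₂, .pop₁, .push₁, .done}, fun x => by cases x <;> simp⟩

section ProdStk

variable (tm₁ tm₂ : FinTM2) (A B C : Type)

/-- The alphabets of the stacks of `prodMachine`. -/
abbrev ProdAlph : tm₁.K ⊕ tm₂.K ⊕ ProdStack → Type :=
  SumAlph tm₁.Γ (SumAlph tm₂.Γ fun
    | .input => A
    | .copy => A
    | .rev => B ⊕ C
    | .output => B ⊕ C)

/-- The stack contents of `prodMachine`. -/
def prodStk (S₁ : ∀ k, List (tm₁.Γ k)) (S₂ : ∀ k, List (tm₂.Γ k)) (i c : List A)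
    (r o : List (B ⊕ C)) : ∀ k, List (ProdAlph tm₁ tm₂ A B C k) :=
  sumStk S₁ (sumStk S₂ fun
    | .input => i
    | .copy => c
    | .rev => r
    | .output => o)

variable {tm₁ tm₂ A B C} (S₁ : ∀ k, List (tm₁.Γ k)) (S₂ : ∀ k, List (tm₂.Γ k)) (i c : List A)
  (r o : List (B ⊕ C))

@[simp] theorem prodStk_inl (k) : prodStk tm₁ tm₂ A B C S₁ S₂ i c r o (.inl k) = S₁ k := rfl

@[simp] theorem prodStk_inr (k) : prodStk tm₁ tm₂ A B C S₁ S₂ i c r o (.inr (.inl k)) = S₂ k := rfl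

@[simp] theorem prodStk_input :
    prodStk tm₁ tm₂ A B C S₁ S₂ i c r o (.inr (.inr .input)) = i := rfl

@[simp] theorem prodStk_copy :
    prodStk tm₁ tm₂ A B C S₁ S₂ i c r o (.inr (.inr .copy)) = c := rfl

@[simp] theorem prodStk_rev :
    prodStk tm₁ tm₂ A B C S₁ S₂ i c r o (.inr (.inr .rev)) = r := rfl

@[simp] theorem prodStk_output :
    prodStk tm₁ tm₂ A B C S₁ S₂ i c r o (.inr (.inr .output)) = o := rfl

theorem prodStk_nil :
    prodStk tm₁ tm₂ A B C (fun _ => []) (fun _ => []) [] [] [] [] = fun _ => [] := by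
  rw [prodStk, ← sumStk_nil, ← sumStk_nil]
  congr 2; funext k; cases k <;> rfl

@[simp] theorem update_prodStk_inl (k l) :
    Function.update (prodStk tm₁ tm₂ A B C S₁ S₂ i c r o) (.inl k) l =
      prodStk tm₁ tm₂ A B C (Function.update S₁ k l) S₂ i c r o := by
  simp [prodStk]

@[simp] theorem update_prodStk_inr (k l) :
    Function.update (prodStk tm₁ tm₂ A B C S₁ S₂ i c r o) (.inr (.inl k)) l =
      prodStk tm₁ tm₂ A B C S₁ (Function.update S₂ k l) i c r o := by
  simp [prodStk]

@[simp] theorem update_prodStk_input (l) :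
    Function.update (prodStk tm₁ tm₂ A B C S₁ S₂ i c r o) (.inr (.inr .input)) l =
      prodStk tm₁ tm₂ A B C S₁ S₂ l c r o := by
  simp only [prodStk, update_sumStk_inr]
  congr 2; funext k; cases k <;> simp

@[simp] theorem update_prodStk_copy (l) :
    Function.update (prodStk tm₁ tm₂ A B C S₁ S₂ i c r o) (.inr (.inr .copy)) l =
      prodStk tm₁ tm₂ A B C S₁ S₂ i l r o := by
  simp only [prodStk, update_sumStk_inr]
  congr 2; funext k; cases k <;> simp

@[simp] theorem update_prodStk_rev (l) :
    Function.update (prodStk tm₁ tm₂ A B C S₁ S₂ i c r o) (.inr (.inr .rev)) l =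
      prodStk tm₁ tm₂ A B C S₁ S₂ i c l o := by
  simp only [prodStk, update_sumStk_inr]
  congr 2; funext k; cases k <;> simp

@[simp] theorem update_prodStk_output (l) :
    Function.update (prodStk tm₁ tm₂ A B C S₁ S₂ i c r o) (.inr (.inr .output)) l =
      prodStk tm₁ tm₂ A B C S₁ S₂ i c r l := by
  simp only [prodStk, update_sumStk_inr]
  congr 2; funext k; cases k <;> simp

end ProdStk

section Prod

variable (tm₁ tm₂ : FinTM2) (A B C : Type) [Inhabited A] [Inhabited C]
  (d₁ : tm₁.Γ tm₁.k₀ ≃ A) (d₂ : tm₂.Γ tm₂.k₀ ≃ A) (e₁ : tm₁.Γ tm₁.k₁ ≃ B)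
  (e₂ : tm₂.Γ tm₂.k₁ ≃ C)

/-- The internal states of `prodMachine`. -/
abbrev ProdState : Type := (tm₁.σ × tm₂.σ) × Option A × Option (B ⊕ C)

open ProdPhase ProdStack in
/-- Run `tm₁` and `tm₂` on two copies of the input, and concatenate the outputs. -/
def prodMachine : tm₁.Λ ⊕ tm₂.Λ ⊕ ProdPhase →
    TM2.Stmt (ProdAlph tm₁ tm₂ A B C) (tm₁.Λ ⊕ tm₂.Λ ⊕ ProdPhase) (ProdState tm₁ tm₂ A B C)
  | .inl l => embedStmt .inl (fun _ => Equiv.refl _) (fun v => v.1.1)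
      (fun v s => ((s, v.1.2), v.2)) .inl (.inr (.inl tm₂.main)) (tm₁.m l)
  | .inr (.inl l) => embedStmt (fun k => .inr (.inl k)) (fun _ => Equiv.refl _) (fun v => v.1.2)
      (fun v s => ((v.1.1, s), v.2)) (fun l => .inr (.inl l)) (.inr (.inr pop₂)) (tm₂.m l)
  | .inr (.inr start) => moveStmt (Γ := ProdAlph tm₁ tm₂ A B C)
      (.inr (.inr input)) (.inr (.inr copy)) id (fun x => x.getD default)
      (fun v => v.2.1) (fun v x => (v.1, x, v.2.2)) (.inr (.inr start)) (.inr (.inr duplicate))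
  | .inr (.inr duplicate) =>
      .pop (.inr (.inr copy)) (fun v x => (v.1, x, v.2.2)) <|
        .branch (fun v => v.2.1.isSome)
          (.push (.inl tm₁.k₀) (fun v => d₁.symm (v.2.1.getD default)) <|
            .push (.inr (.inl tm₂.k₀)) (fun v => d₂.symm (v.2.1.getD default)) <|
              .goto fun _ => .inr (.inr duplicate))
          (.goto fun _ => .inl tm₁.main)
  | .inr (.inr pop₂) => moveStmt (Γ := ProdAlph tm₁ tm₂ A B C)
      (.inr (.inl tm₂.k₁)) (.inr (.inr rev)) (fun x => .inr (e₂ x)) (fun x => x.getD default)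
      (fun v => v.2.2) (fun v x => (v.1, v.2.1, x)) (.inr (.inr pop₂)) (.inr (.inr push₂))
  | .inr (.inr push₂) => moveStmt (Γ := ProdAlph tm₁ tm₂ A B C)
      (.inr (.inr rev)) (.inr (.inr output)) id (fun x => x.getD default)
      (fun v => v.2.2) (fun v x => (v.1, v.2.1, x)) (.inr (.inr push₂)) (.inr (.inr pop₁))
  | .inr (.inr pop₁) => moveStmt (Γ := ProdAlph tm₁ tm₂ A B C)
      (.inl tm₁.k₁) (.inr (.inr rev)) (fun x => .inl (e₁ x)) (fun x => x.getD default)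
      (fun v => v.2.2) (fun v x => (v.1, v.2.1, x)) (.inr (.inr pop₁)) (.inr (.inr push₁))
  | .inr (.inr push₁) => moveStmt (Γ := ProdAlph tm₁ tm₂ A B C)
      (.inr (.inr rev)) (.inr (.inr output)) id (fun x => x.getD default)
      (fun v => v.2.2) (fun v x => (v.1, v.2.1, x)) (.inr (.inr push₁)) (.inr (.inr done))
  | .inr (.inr done) => .halt

/-- This pass reverses the word. It is applied to the already reversed input, so both machines
receive the original. -/
theorem Steps.duplicate (v : tm₁.σ × tm₂.σ) (w : Option (B ⊕ C)) (b : Option A) (c : List A)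
    (x₁ : List (tm₁.Γ tm₁.k₀)) (x₂ : List (tm₂.Γ tm₂.k₀)) :
    Steps (prodMachine tm₁ tm₂ A B C d₁ d₂ e₁ e₂) (c.length + 1)
      ⟨some (.inr (.inr .duplicate)), (v, b, w), prodStk tm₁ tm₂ A B C
        (Function.update (fun _ => []) tm₁.k₀ x₁) (Function.update (fun _ => []) tm₂.k₀ x₂)
        [] c [] []⟩
      ⟨some (.inl tm₁.main), (v, none, w), prodStk tm₁ tm₂ A B C
        (Function.update (fun _ => []) tm₁.k₀ ((c.map d₁.symm).reverse ++ x₁))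
        (Function.update (fun _ => []) tm₂.k₀ ((c.map d₂.symm).reverse ++ x₂)) [] [] [] []⟩ := by
  induction c generalizing b x₁ x₂ with
  | nil => exact Steps.one (by simp [prodMachine])
  | cons a c ih =>
    rw [List.length_cons, Nat.add_comm _ 1]
    have := ih (some a) (d₁.symm a :: x₁) (d₂.symm a :: x₂)
    simp only [List.map_cons, List.reverse_cons, List.append_assoc, List.singleton_append]
    exact Steps.trans (Steps.one (by simp [prodMachine])) this

/-- A stack is filled from its bottom, so the second output is unloaded before the first. Each of
the three words is traversed twice, hence the factors 2. -/
theorem prodMachine_transforms {x : List A} {y : List B} {z : List C} {t₁ t₂ : ℕ}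
    (h₁ : Transforms tm₁.m tm₁.k₀ tm₁.k₁ tm₁.main tm₁.initialState (x.map d₁.symm)
      (y.map e₁.symm) t₁)
    (h₂ : Transforms tm₂.m tm₂.k₀ tm₂.k₁ tm₂.main tm₂.initialState (x.map d₂.symm)
      (z.map e₂.symm) t₂) :
    Transforms (prodMachine tm₁ tm₂ A B C d₁ d₂ e₁ e₂) (.inr (.inr .input)) (.inr (.inr .output))
      (.inr (.inr .start)) ((tm₁.initialState, tm₂.initialState), none, none) x
      (y.map .inl ++ z.map .inr)
      (2 * (x.length + 1) + t₁ + t₂ + 2 * (y.length + 1) + 2 * (z.length + 1) + 1) := by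
  obtain ⟨n₁, hn₁, h₁⟩ := h₁
  obtain ⟨n₂, hn₂, h₂⟩ := h₂
  let M := prodMachine tm₁ tm₂ A B C d₁ d₂ e₁ e₂
  let s : ProdState tm₁ tm₂ A B C := ((tm₁.initialState, tm₂.initialState), none, none)
  have r₁ := Steps.move (M := M) (lbl := .inr (.inr .start))
    (a := .inr (.inr .input)) (b := .inr (.inr .copy)) (f := id) (g := fun x => x.getD default)
    (get := fun v => v.2.1) (put := fun v x => (v.1, x, v.2.2)) (nxt := .inr (.inr .duplicate)) rfl
    (by simp) (fun _ _ => rfl) (fun _ _ _ => rfl) s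
    (prodStk tm₁ tm₂ A B C (fun _ => []) (fun _ => []) x [] [] [])
  have r₂ := Steps.duplicate tm₁ tm₂ A B C d₁ d₂ e₁ e₂ (tm₁.initialState, tm₂.initialState) none
    none x.reverse [] []
  have r₃ := h₁.embed (M' := M) (ι := Sum.inl)
    (e := fun _ => Equiv.refl _) (get := fun v => v.1.1) (set := fun v s => ((s, v.1.2), v.2))
    (lab := Sum.inl) (cont := .inr (.inl tm₂.main))
    (mkV := fun s => ((s, tm₂.initialState), none, none))
    (mkS := fun S => prodStk tm₁ tm₂ A B C S
      (Function.update (fun _ => []) tm₂.k₀ (x.map d₂.symm)) [] [] [] [])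
    (fun l => rfl) (fun _ => rfl) (fun _ _ => rfl) (by simp) (by simp)
  have r₄ := h₂.embed (M' := M) (ι := fun k => .inr (.inl k))
    (e := fun _ => Equiv.refl _) (get := fun v => v.1.2) (set := fun v s => ((v.1.1, s), v.2))
    (lab := fun l => .inr (.inl l)) (cont := .inr (.inr .pop₂))
    (mkV := fun s => ((tm₁.initialState, s), none, none))
    (mkS := fun S => prodStk tm₁ tm₂ A B C
      (Function.update (fun _ => []) tm₁.k₁ (y.map e₁.symm)) S [] [] [] [])
    (fun l => rfl) (fun _ => rfl) (fun _ _ => rfl) (by simp) (by simp)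
  have r₅ := Steps.move (M := M) (lbl := .inr (.inr .pop₂))
    (a := .inr (.inl tm₂.k₁)) (b := .inr (.inr .rev)) (f := fun x => .inr (e₂ x))
    (g := fun x => x.getD default)
    (get := fun v => v.2.2) (put := fun v x => (v.1, v.2.1, x)) (nxt := .inr (.inr .push₂)) rfl
    (by simp) (fun _ _ => rfl) (fun _ _ _ => rfl) s
    (prodStk tm₁ tm₂ A B C (Function.update (fun _ => []) tm₁.k₁ (y.map e₁.symm))
      (Function.update (fun _ => []) tm₂.k₁ (z.map e₂.symm)) [] [] [] [])
  have r₆ := Steps.move (M := M) (lbl := .inr (.inr .push₂))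
    (a := .inr (.inr .rev)) (b := .inr (.inr .output)) (f := id)
    (g := fun x => x.getD default)
    (get := fun v => v.2.2) (put := fun v x => (v.1, v.2.1, x)) (nxt := .inr (.inr .pop₁)) rfl
    (by simp) (fun _ _ => rfl) (fun _ _ _ => rfl) s
    (prodStk tm₁ tm₂ A B C (Function.update (fun _ => []) tm₁.k₁ (y.map e₁.symm))
      (fun _ => []) [] [] (z.map .inr).reverse [])
  have r₇ := Steps.move (M := M) (lbl := .inr (.inr .pop₁))
    (a := .inl tm₁.k₁) (b := .inr (.inr .rev)) (f := fun x => .inl (e₁ x))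
    (g := fun x => x.getD default)
    (get := fun v => v.2.2) (put := fun v x => (v.1, v.2.1, x)) (nxt := .inr (.inr .push₁)) rfl
    (by simp) (fun _ _ => rfl) (fun _ _ _ => rfl) s
    (prodStk tm₁ tm₂ A B C (Function.update (fun _ => []) tm₁.k₁ (y.map e₁.symm))
      (fun _ => []) [] [] [] (z.map .inr))
  have r₈ := Steps.move (M := M) (lbl := .inr (.inr .push₁))
    (a := .inr (.inr .rev)) (b := .inr (.inr .output)) (f := id)
    (g := fun x => x.getD default)
    (get := fun v => v.2.2) (put := fun v x => (v.1, v.2.1, x)) (nxt := .inr (.inr .done)) rfl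
    (by simp) (fun _ _ => rfl) (fun _ _ _ => rfl) s
    (prodStk tm₁ tm₂ A B C (fun _ => []) (fun _ => []) [] [] (y.map .inl).reverse (z.map .inr))
  have r₉ := Steps.one (M := M) (l := .inr (.inr .done)) (v := s)
    (S := prodStk tm₁ tm₂ A B C (fun _ => []) (fun _ => []) [] [] [] (y.map .inl ++ z.map .inr)) rfl
  simp [Function.comp_def, s] at r₁ r₂ r₃ r₄ r₅ r₆ r₇ r₈ r₉
  refine ⟨x.length + 1 + (x.length + 1) + n₁ + n₂ + (z.length + 1) + (z.length + 1) +
    (y.length + 1) + (y.length + 1) + 1, by omega, ?_⟩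
  rw [← prodStk_nil, update_prodStk_input, update_prodStk_output]
  exact (((((((r₁.trans r₂).trans r₃).trans r₄).trans r₅).trans r₆).trans r₇).trans r₈).trans r₉

end Prod

/-- The encoding of pairs as concatenated words over disjoint alphabets. -/
def encodeProd {β γ βΓ γΓ : Type} (eb : β → List βΓ) (ec : γ → List γΓ) (p : β × γ) :
    List (βΓ ⊕ γΓ) :=
  (eb p.1).map .inl ++ (ec p.2).map .inr

theorem PolyTime.prodMk {α β γ αΓ βΓ γΓ : Type} [Inhabited αΓ] [Inhabited γΓ]
    [Fintype βΓ] [Fintype γΓ] {ea : α → List αΓ} {eb : β → List βΓ} {ec : γ → List γΓ}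
    {f : α → β} {g : α → γ} (hf : PolyTime ea eb f) (hg : PolyTime ea ec g) :
    PolyTime ea (encodeProd eb ec) (fun a => (f a, g a)) := by
  obtain ⟨q₁, hq₁⟩ := hf.exists_length_le
  obtain ⟨q₂, hq₂⟩ := hg.exists_length_le
  obtain ⟨tm₁, d₁, e₁, p₁, h₁⟩ := hf.exists_transforms
  obtain ⟨tm₂, d₂, e₂, p₂, h₂⟩ := hg.exists_transforms
  let _ := tm₁.kFin
  let _ := tm₂.kFin
  let _ := tm₁.ΛFin
  let _ := tm₂.ΛFin
  let _ := tm₁.σFin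
  let _ := tm₂.σFin
  let _ := tm₁.Γk₀Fin
  let _ : Fintype αΓ := Fintype.ofEquiv _ d₁
  let _ : Fintype (ProdAlph tm₁ tm₂ αΓ βΓ γΓ (.inr (.inr .input))) := inferInstanceAs (Fintype αΓ)
  refine polyTime_of_transforms (prodMachine tm₁ tm₂ αΓ βΓ γΓ d₁ d₂ e₁ e₂) (.inr (.inr .input))
    (.inr (.inr .output)) (.inr (.inr .start))
    ((tm₁.initialState, tm₂.initialState), none, none) (Equiv.refl _) (Equiv.refl _)
    (2 * (Polynomial.X + 1) + p₁ + p₂ + 2 * (q₁ + 1) + 2 * (q₂ + 1) + 1) fun a => ?_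
  obtain ⟨n, hn, h⟩ := prodMachine_transforms tm₁ tm₂ αΓ βΓ γΓ d₁ d₂ e₁ e₂ (h₁ a) (h₂ a)
  refine ⟨n, hn.trans ?_, by simpa [encodeProd] using h⟩
  have := hq₁ a
  have := hq₂ a
  simp
  omega

/-! ### Finite-state transducers -/

section PushList

variable {K : Type} [DecidableEq K] {Γ : K → Type} {Λ V : Type}

/-- Push the symbols of the word `f v`, which has length at most `n`, on the stack `k`. -/
def pushList (k : K) [Inhabited (Γ k)] : ℕ → (V → List (Γ k)) → TM2.Stmt Γ Λ V → TM2.Stmt Γ Λ V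
  | 0, _, q => q
  | n + 1, f, q =>
    .branch (fun v => (f v).isEmpty) q <|
      .push k (fun v => (f v).head?.getD default) (pushList k n (fun v => (f v).tail) q)

/-- A statement is a fixed finite tree, so a word that depends on the state can be pushed in a
single step only under an a priori bound `n` on its length. -/
theorem stepAux_pushList (k : K) [Inhabited (Γ k)] (n : ℕ) (f : V → List (Γ k))
    (q : TM2.Stmt Γ Λ V) (v : V) (S : ∀ k, List (Γ k)) (h : (f v).length ≤ n) :
    TM2.stepAux (pushList k n f q) v S =
      TM2.stepAux q v (Function.update S k ((f v).reverse ++ S k)) := by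
  induction n generalizing f S with
  | zero =>
    have : f v = [] := by simpa using h
    simp [pushList, this]
  | succ n ih =>
    cases hf : f v with
    | nil => simp [pushList, hf]
    | cons b l =>
      simp only [pushList, TM2.stepAux, hf, List.isEmpty_cons, cond_false]
      rw [ih _ _ (by rw [hf] at h; simpa [hf] using h)]
      simp [hf]

end PushList

section Transducer

variable {A B S : Type}

/-- The output of a finite-state transducer started in state `s`. -/
def transduce (step : S → A → S × List B) (fin : S → List B) (s : S) : List A → List B
  | [] => fin s
  | a :: l => (step s a).2 ++ transduce step fin (step s a).1 l

theorem length_transduce_le {step : S → A → S × List B} {fin : S → List B} {n : ℕ}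
    (h₁ : ∀ s a, (step s a).2.length ≤ n) (h₂ : ∀ s, (fin s).length ≤ n) (s : S)
    (x : List A) : (transduce step fin s x).length ≤ n * (x.length + 1) := by
  induction x generalizing s with
  | nil => simpa [transduce] using h₂ s
  | cons a x ih =>
    have := ih (step s a).1
    have := h₁ s a
    simp only [transduce, List.length_append, List.length_cons]
    rw [mul_add n (x.length + 1) 1, mul_one]
    omega

/-- The stacks of a transducer. -/
inductive TransStack
  | input
  | rev
  | output
  deriving DecidableEq

/-- The phases of a transducer. -/
inductive TransPhase
  | scan
  | reverse
  | done
  deriving DecidableEq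

instance : Fintype TransStack := ⟨{.input, .rev, .output}, fun x => by cases x <;> simp⟩

instance : Fintype TransPhase := ⟨{.scan, .reverse, .done}, fun x => by cases x <;> simp⟩

/-- The alphabets of the stacks of a transducer. -/
abbrev TransAlph (A B : Type) : TransStack → Type
  | .input => A
  | .rev => B
  | .output => B

/-- The stack contents of a transducer. -/
def transStk (i : List A) (r o : List B) : ∀ k, List (TransAlph A B k)
  | .input => i
  | .rev => r
  | .output => o

@[simp] theorem transStk_input (i : List A) (r o : List B) : transStk i r o .input = i := rfl

@[simp] theorem transStk_rev (i : List A) (r o : List B) : transStk i r o .rev = r := rfl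

@[simp] theorem transStk_output (i : List A) (r o : List B) : transStk i r o .output = o := rfl

@[simp] theorem update_transStk_input (i l : List A) (r o : List B) :
    Function.update (transStk i r o) .input l = transStk l r o := by
  funext k; cases k <;> simp

@[simp] theorem update_transStk_rev (i : List A) (r o l : List B) :
    Function.update (transStk i r o) .rev l = transStk i l o := by
  funext k; cases k <;> simp

@[simp] theorem update_transStk_output (i : List A) (r o l : List B) :
    Function.update (transStk i r o) .output l = transStk i r l := by
  funext k; cases k <;> simp

theorem transStk_nil : transStk ([] : List A) ([] : List B) [] = fun _ => [] := by
  funext k; cases k <;> rfl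

variable [Inhabited A] [Inhabited B] (step : S → A → S × List B) (fin : S → List B)
  (s₀ : S) (n : ℕ)

instance : Inhabited (TransAlph A B .rev) := inferInstanceAs (Inhabited B)

/-- The machine that executes a transducer emitting at most `n` symbols at a time. -/
def transMachine : TransPhase → TM2.Stmt (TransAlph A B) TransPhase (S × Option A × Option B)
  | .scan =>
    .pop .input (fun v x => (v.1, x, none)) <|
      .branch (fun v => v.2.1.isSome)
        (pushList .rev n (fun v => (step v.1 (v.2.1.getD default)).2) <|
          .load (fun v => ((step v.1 (v.2.1.getD default)).1, none, none)) <|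
            .goto fun _ => .scan)
        (pushList .rev n (fun v => fin v.1) <|
          .load (fun _ => (s₀, none, none)) <| .goto fun _ => .reverse)
  | .reverse => moveStmt (Γ := TransAlph A B) .rev .output id (fun x => x.getD default)
      (fun v => v.2.2) (fun v x => (v.1, v.2.1, x)) .reverse .done
  | .done => .halt

variable {step fin s₀ n}

theorem Steps.transScan (h₁ : ∀ s a, (step s a).2.length ≤ n) (h₂ : ∀ s, (fin s).length ≤ n)
    (s : S) (x : List A) (r : List B) :
    Steps (transMachine step fin s₀ n) (x.length + 1)
      ⟨some .scan, (s, none, none), transStk x r []⟩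
      ⟨some .reverse, (s₀, none, none), transStk [] ((transduce step fin s x).reverse ++ r) []⟩ := by
  induction x generalizing s r with
  | nil =>
    refine Steps.one ?_
    simp [transMachine, stepAux_pushList, h₂, transduce]
  | cons a x ih =>
    rw [List.length_cons, Nat.add_comm _ 1]
    simp only [transduce, List.reverse_append, List.append_assoc]
    refine Steps.trans (Steps.one ?_) (ih _ _)
    simp [transMachine, stepAux_pushList, h₁]

/-- Finitely many states and symbols give a uniform bound on a single emission, so the output is
linear in the input; one scan and one reversal suffice. -/
theorem PolyTime.of_transduce {α β : Type} [Fintype A] [Fintype B] [Fintype S]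
    {ea : α → List A} {eb : β → List B} {f : α → β}
    (step : S → A → S × List B) (fin : S → List B) (s₀ : S)
    (h : ∀ a, eb (f a) = transduce step fin s₀ (ea a)) : PolyTime ea eb f := by
  obtain ⟨n₁, hn₁⟩ := (Set.finite_range fun p : S × A => (step p.1 p.2).2.length).bddAbove
  obtain ⟨n₂, hn₂⟩ := (Set.finite_range fun s => (fin s).length).bddAbove
  have h₁ : ∀ s a, (step s a).2.length ≤ max n₁ n₂ := fun s a =>
    le_max_of_le_left (hn₁ ⟨(s, a), rfl⟩)
  have h₂ : ∀ s, (fin s).length ≤ max n₁ n₂ := fun s => le_max_of_le_right (hn₂ ⟨s, rfl⟩)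
  let _ : Fintype (TransAlph A B .input) := inferInstanceAs (Fintype A)
  refine polyTime_of_transforms (transMachine step fin s₀ (max n₁ n₂)) .input .output .scan
    (s₀, none, none) (Equiv.refl _) (Equiv.refl _)
    (Polynomial.X + 1 + (Polynomial.C (max n₁ n₂) * (Polynomial.X + 1) + 1) + 1) fun a => ?_
  have r₁ := Steps.transScan (s₀ := s₀) h₁ h₂ s₀ (ea a) []
  have r₂ := Steps.move (M := transMachine step fin s₀ (max n₁ n₂)) (lbl := .reverse)
    (a := .rev) (b := .output) (f := id) (g := fun x => x.getD default)
    (get := fun v => v.2.2) (put := fun v x => (v.1, v.2.1, x)) (nxt := .done) rfl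
    (by simp) (fun _ _ => rfl) (fun _ _ _ => rfl) (s₀, none, none)
    (transStk [] (transduce step fin s₀ (ea a)).reverse [])
  have r₃ := Steps.one (M := transMachine step fin s₀ (max n₁ n₂)) (l := .done)
    (v := (s₀, none, none)) (S := transStk [] [] (transduce step fin s₀ (ea a)))
    (d := ⟨none, (s₀, none, none), transStk [] [] (transduce step fin s₀ (ea a))⟩) rfl
  simp at r₁ r₂
  refine ⟨_, ?_, by
    rw [← transStk_nil, update_transStk_input, update_transStk_output, h]
    simpa using (r₁.trans r₂).trans r₃⟩
  have := length_transduce_le h₁ h₂ s₀ (ea a)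
  simp only [Polynomial.eval_add, Polynomial.eval_mul, Polynomial.eval_C, Polynomial.eval_X,
    Polynomial.eval_one]
  omega

end Transducer

/-! ### Unary arithmetic -/

/-- Unary representation of natural numbers. -/
def encodeUnary (n : ℕ) : List Unit := List.replicate n ()

/-- The stacks of the machines for unary arithmetic. -/
inductive ArithStack
  | input
  | left
  | right
  | aux
  | output
  deriving DecidableEq

instance : Fintype ArithStack :=
  ⟨{.input, .left, .right, .aux, .output}, fun x => by cases x <;> simp⟩

/-- The alphabets of the stacks of the machines for unary arithmetic. -/
abbrev ArithAlph (B : Type) : ArithStack → Type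
  | .input => Unit ⊕ Unit
  | .left => Unit
  | .right => Unit
  | .aux => Unit
  | .output => B

section ArithStk

variable {B : Type}

/-- The stack contents of the machines for unary arithmetic. -/
def arithStk (i : List (Unit ⊕ Unit)) (l r a : ℕ) (o : List B) : ∀ k, List (ArithAlph B k)
  | .input => i
  | .left => encodeUnary l
  | .right => encodeUnary r
  | .aux => encodeUnary a
  | .output => o

variable (i : List (Unit ⊕ Unit)) (l r a : ℕ) (o : List B)

@[simp] theorem arithStk_input : arithStk i l r a o .input = i := rfl

@[simp] theorem arithStk_left : arithStk i l r a o .left = encodeUnary l := rfl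

@[simp] theorem arithStk_right : arithStk i l r a o .right = encodeUnary r := rfl

@[simp] theorem arithStk_aux : arithStk i l r a o .aux = encodeUnary a := rfl

@[simp] theorem arithStk_output : arithStk i l r a o .output = o := rfl

@[simp] theorem update_arithStk_input (x) :
    Function.update (arithStk i l r a o) .input x = arithStk x l r a o := by
  funext k; cases k <;> simp

@[simp] theorem update_arithStk_left (x) :
    Function.update (arithStk i l r a o) .left (encodeUnary x) = arithStk i x r a o := by
  funext k; cases k <;> simp

@[simp] theorem update_arithStk_right (x) :
    Function.update (arithStk i l r a o) .right (encodeUnary x) = arithStk i l x a o := by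
  funext k; cases k <;> simp

@[simp] theorem update_arithStk_aux (x) :
    Function.update (arithStk i l r a o) .aux (encodeUnary x) = arithStk i l r x o := by
  funext k; cases k <;> simp

@[simp] theorem update_arithStk_output (x) :
    Function.update (arithStk i l r a o) .output x = arithStk i l r a x := by
  funext k; cases k <;> simp

theorem arithStk_nil : arithStk [] 0 0 0 ([] : List B) = fun _ => [] := by
  funext k; cases k <;> rfl

@[simp] theorem cons_encodeUnary (n : ℕ) (u : Unit) : u :: encodeUnary n = encodeUnary (n + 1) :=
  rfl

@[simp] theorem map_encodeUnary_succ {A : Type} (f : Unit → A) (n : ℕ) :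
    (encodeUnary (n + 1)).map f = f () :: (encodeUnary n).map f :=
  rfl

@[simp] theorem head?_encodeUnary_succ (n : ℕ) : (encodeUnary (n + 1)).head? = some () := rfl

@[simp] theorem head?_encodeUnary_zero : (encodeUnary 0).head? = none := rfl

@[simp] theorem tail_encodeUnary (n : ℕ) : (encodeUnary n).tail = encodeUnary (n - 1) := by
  cases n <;> rfl

end ArithStk

/-- The phases of the machines for unary arithmetic. -/
inductive ArithPhase
  | split
  | outer
  | copy
  | restore
  | drain
  deriving DecidableEq

instance : Fintype ArithPhase :=
  ⟨{.split, .outer, .copy, .restore, .drain}, fun x => by cases x <;> simp⟩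

/-- Multiplication of unary numbers. -/
def mulMachine : ArithPhase → TM2.Stmt (ArithAlph Unit) ArithPhase (Option (Unit ⊕ Unit))
  | .split =>
    .pop .input (fun _ x => x) <|
      .branch (fun v => v.isSome)
        (.branch (fun v => (v.getD default).isLeft)
          (.push .left (fun _ => ()) <| .goto fun _ => .split)
          (.push .right (fun _ => ()) <| .goto fun _ => .split))
        (.goto fun _ => .outer)
  | .outer =>
    .pop .left (fun _ x => x.map .inl) <|
      .branch (fun v => v.isSome) (.goto fun _ => .copy) (.goto fun _ => .drain)
  | .copy =>
    .pop .right (fun _ x => x.map .inl) <|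
      .branch (fun v => v.isSome)
        (.push .aux (fun _ => ()) <| .push .output (fun _ => ()) <| .goto fun _ => .copy)
        (.goto fun _ => .restore)
  | .restore =>
    .pop .aux (fun _ x => x.map .inl) <|
      .branch (fun v => v.isSome)
        (.push .right (fun _ => ()) <| .goto fun _ => .restore)
        (.goto fun _ => .outer)
  | .drain =>
    .pop .right (fun _ x => x.map .inl) <|
      .branch (fun v => v.isSome) (.goto fun _ => .drain) .halt

theorem mulMachine_split_right (v : Option (Unit ⊕ Unit)) (l r n : ℕ) :
    Steps mulMachine (n + 1)
      ⟨some .split, v, arithStk ((encodeUnary n).map .inr) l r 0 []⟩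
      ⟨some .outer, none, arithStk [] l (r + n) 0 []⟩ := by
  induction n generalizing v r with
  | zero => exact Steps.one (by simp [mulMachine, encodeUnary])
  | succ n ih =>
    have h := ih (some (.inr ())) (r + 1)
    rw [Nat.add_assoc, Nat.add_comm 1] at h
    exact h.cons (by simp [mulMachine]) rfl

theorem mulMachine_split (v : Option (Unit ⊕ Unit)) (l m n : ℕ) :
    Steps mulMachine (m + (n + 1))
      ⟨some .split, v, arithStk ((encodeUnary m).map .inl ++ (encodeUnary n).map .inr) l 0 0 []⟩
      ⟨some .outer, none, arithStk [] (l + m) n 0 []⟩ := by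
  induction m generalizing v l with
  | zero => simpa [encodeUnary] using mulMachine_split_right v l 0 n
  | succ m ih =>
    have h := ih (some (.inl ())) (l + 1)
    rw [Nat.add_assoc l, Nat.add_comm 1] at h
    exact h.cons (by simp [mulMachine]) (Nat.add_right_comm _ _ _)

theorem mulMachine_copy (v : Option (Unit ⊕ Unit)) (l r a o : ℕ) :
    Steps mulMachine (r + 1)
      ⟨some .copy, v, arithStk [] l r a (encodeUnary o)⟩
      ⟨some .restore, none, arithStk [] l 0 (a + r) (encodeUnary (o + r))⟩ := by
  induction r generalizing v a o with
  | zero => exact Steps.one (by simp [mulMachine])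
  | succ r ih =>
    have h := ih (some (.inl ())) (a + 1) (o + 1)
    rw [Nat.add_assoc, Nat.add_assoc, Nat.add_comm 1] at h
    exact h.cons (by simp [mulMachine]) rfl

theorem mulMachine_restore (v : Option (Unit ⊕ Unit)) (l r a : ℕ) (o : List Unit) :
    Steps mulMachine (a + 1)
      ⟨some .restore, v, arithStk [] l r a o⟩
      ⟨some .outer, none, arithStk [] l (r + a) 0 o⟩ := by
  induction a generalizing v r with
  | zero => exact Steps.one (by simp [mulMachine])
  | succ a ih =>
    have h := ih (some (.inl ())) (r + 1)
    rw [Nat.add_assoc, Nat.add_comm 1] at h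
    exact h.cons (by simp [mulMachine]) rfl

/-- Multiplication as repeated addition. A round takes one pop, `r + 1` steps to copy `right` to the
output and to `aux`, and `r + 1` steps to restore it, which makes `2 * r + 3`. -/
theorem mulMachine_outer (l r o : ℕ) :
    Steps mulMachine (l * (2 * r + 3) + 1)
      ⟨some .outer, none, arithStk [] l r 0 (encodeUnary o)⟩
      ⟨some .drain, none, arithStk [] 0 r 0 (encodeUnary (o + l * r))⟩ := by
  induction l generalizing o with
  | zero => exact (Steps.refl _).cons (by simp [mulMachine]) (by simp)
  | succ l ih =>
    have h₁ : Steps mulMachine 1 ⟨some .outer, none, arithStk [] (l + 1) r 0 (encodeUnary o)⟩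
        ⟨some .copy, some (.inl ()), arithStk [] l r 0 (encodeUnary o)⟩ :=
      Steps.one (by simp [mulMachine])
    have h₂ := mulMachine_copy (some (.inl ())) l r 0 o
    have h₃ := mulMachine_restore none l 0 r (encodeUnary (o + r))
    simp only [Nat.zero_add] at h₂ h₃
    convert ((h₁.trans h₂).trans h₃).trans (ih (o + r)) using 1
    · ring
    · congr 3; ring

theorem mulMachine_drain (v : Option (Unit ⊕ Unit)) (r : ℕ) (o : List Unit) :
    Steps mulMachine (r + 1)
      ⟨some .drain, v, arithStk [] 0 r 0 o⟩ ⟨none, none, arithStk [] 0 0 0 o⟩ := by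
  induction r generalizing v with
  | zero => exact Steps.one (by simp [mulMachine])
  | succ r ih =>
    exact (ih (some (.inl ()))).cons (by simp [mulMachine]) rfl

theorem polyTime_mul :
    PolyTime (encodeProd encodeUnary encodeUnary) encodeUnary (fun p : ℕ × ℕ => p.1 * p.2) := by
  let _ : Fintype (ArithAlph Unit .input) := inferInstanceAs (Fintype (Unit ⊕ Unit))
  refine polyTime_of_transforms mulMachine .input .output .split none (Equiv.refl _)
    (Equiv.refl _) (Polynomial.X + 1 + (Polynomial.X * (2 * Polynomial.X + 3) + 1) +
      (Polynomial.X + 1)) fun p => ?_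
  obtain ⟨m, n⟩ := p
  have r₁ := mulMachine_split none 0 m n
  have r₂ := mulMachine_outer m n 0
  have r₃ := mulMachine_drain none n (encodeUnary (m * n))
  simp only [Nat.zero_add] at r₁ r₂
  refine ⟨_, ?_, by
    rw [← arithStk_nil, update_arithStk_input, update_arithStk_output]
    simpa [encodeProd] using (r₁.trans r₂).trans r₃⟩
  have h : (encodeProd encodeUnary encodeUnary (m, n)).length = m + n := by
    simp [encodeProd, encodeUnary]
  simp only [h, Polynomial.eval_add, Polynomial.eval_mul, Polynomial.eval_X,
    Polynomial.eval_one, Polynomial.eval_ofNat]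
  -- The time bound may depend only on the input length `m + n`.
  have : m * (2 * n + 3) ≤ (m + n) * (2 * (m + n) + 3) := by gcongr <;> omega
  omega

/-- Comparison of unary numbers. -/
def leMachine : ArithPhase → TM2.Stmt (ArithAlph Bool) ArithPhase (Option (Unit ⊕ Unit))
  | .split =>
    .pop .input (fun _ x => x) <|
      .branch (fun v => v.isSome)
        (.branch (fun v => (v.getD default).isLeft)
          (.push .left (fun _ => ()) <| .goto fun _ => .split)
          (.pop .left (fun v _ => v) <| .goto fun _ => .split))
        (.goto fun _ => .outer)
  | .outer =>
    .peek .left (fun _ x => x.map .inl) <| .push .output (fun v => v.isNone) <|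
      .goto fun _ => .drain
  | _ =>
    .pop .left (fun _ x => x.map .inl) <|
      .branch (fun v => v.isSome) (.goto fun _ => .drain) .halt

/-- Popping an empty stack does nothing, so the pops compute truncated subtraction. The comparison
then only tests whether `left` is empty. -/
theorem leMachine_split_right (v : Option (Unit ⊕ Unit)) (l n : ℕ) :
    Steps leMachine (n + 1)
      ⟨some .split, v, arithStk ((encodeUnary n).map .inr) l 0 0 []⟩
      ⟨some .outer, none, arithStk [] (l - n) 0 0 []⟩ := by
  induction n generalizing v l with
  | zero => exact Steps.one (by simp [leMachine, encodeUnary])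
  | succ n ih =>
    have h := ih (some (.inr ())) (l - 1)
    rw [Nat.sub_sub, Nat.add_comm 1] at h
    exact h.cons (by simp [leMachine]) rfl

theorem leMachine_split (v : Option (Unit ⊕ Unit)) (l m n : ℕ) :
    Steps leMachine (m + (n + 1))
      ⟨some .split, v, arithStk ((encodeUnary m).map .inl ++ (encodeUnary n).map .inr) l 0 0 []⟩
      ⟨some .outer, none, arithStk [] (l + m - n) 0 0 []⟩ := by
  induction m generalizing v l with
  | zero => simpa [encodeUnary] using leMachine_split_right v l n
  | succ m ih =>
    have h := ih (some (.inl ())) (l + 1)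
    rw [Nat.add_assoc l, Nat.add_comm 1] at h
    exact h.cons (by simp [leMachine]) (Nat.add_right_comm _ _ _)

theorem leMachine_drain (v : Option (Unit ⊕ Unit)) (l : ℕ) (o : List Bool) :
    Steps leMachine (l + 1)
      ⟨some .drain, v, arithStk [] l 0 0 o⟩ ⟨none, none, arithStk [] 0 0 0 o⟩ := by
  induction l generalizing v with
  | zero => exact Steps.one (by simp [leMachine])
  | succ l ih =>
    exact (ih (some (.inl ()))).cons (by simp [leMachine]) rfl

theorem polyTime_le :
    PolyTime (encodeProd encodeUnary encodeUnary) encodeBool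
      (fun p : ℕ × ℕ => decide (p.1 ≤ p.2)) := by
  let _ : Fintype (ArithAlph Bool .input) := inferInstanceAs (Fintype (Unit ⊕ Unit))
  refine polyTime_of_transforms leMachine .input .output .split none (Equiv.refl _)
    (Equiv.refl _) (2 * Polynomial.X + 3) fun p => ?_
  obtain ⟨m, n⟩ := p
  have r₁ := leMachine_split none 0 m n
  have r₂ : Steps leMachine 1 ⟨some .outer, none, arithStk [] (m - n) 0 0 []⟩
      ⟨some .drain, (encodeUnary (m - n)).head?.map .inl,
        arithStk [] (m - n) 0 0 [decide (m ≤ n)]⟩ := by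
    refine Steps.one ?_
    cases h : m - n with
    | zero =>
      have : m ≤ n := by omega
      simp [leMachine, this]
    | succ k =>
      have : ¬ m ≤ n := by omega
      simp [leMachine, this]
  have r₃ := leMachine_drain ((encodeUnary (m - n)).head?.map .inl) (m - n) [decide (m ≤ n)]
  rw [Nat.zero_add] at r₁
  refine ⟨_, ?_, by
    rw [← arithStk_nil, update_arithStk_input, update_arithStk_output]
    simpa [encodeProd, encodeBool] using (r₁.trans r₂).trans r₃⟩
  have h : (encodeProd encodeUnary encodeUnary (m, n)).length = m + n := by
    simp [encodeProd, encodeUnary]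
  simp only [h, Polynomial.eval_add, Polynomial.eval_mul, Polynomial.eval_X,
    Polynomial.eval_ofNat]
  omega

/-! ### Polynomial-time computable functions -/

theorem transduce_stateless {A B : Type} (f : A → List B) (e : List B) (l : List A) :
    transduce (fun _ a => ((), f a)) (fun _ => e) () l = l.flatMap f ++ e := by
  induction l with
  | nil => rfl
  | cons a l ih => simp [transduce, ih]

theorem polyTime_id {α A : Type} [Fintype A] [Inhabited A] (ea : α → List A) :
    PolyTime ea ea fun a => a :=
  .of_transduce (fun _ a => ((), [a])) (fun _ => []) () fun a => by
    rw [transduce_stateless]; simp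

theorem polyTime_length : PolyTime id encodeUnary (List.length : Str → ℕ) :=
  .of_transduce (fun _ _ => ((), [()])) (fun _ => []) () fun a => by
    rw [transduce_stateless]
    induction a with
    | nil => rfl
    | cons b a ih => simpa [encodeUnary, List.replicate_succ] using ih

theorem polyTime_add :
    PolyTime (encodeProd encodeUnary encodeUnary) encodeUnary (fun p : ℕ × ℕ => p.1 + p.2) :=
  .of_transduce (fun _ _ => ((), [()])) (fun _ => []) () fun p => by
    rw [transduce_stateless]
    apply List.ext_getElem <;> simp [encodeProd, encodeUnary]

theorem polyTime_const (c : ℕ) : PolyTime encodeUnary encodeUnary (fun _ => c) :=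
  .of_transduce (fun _ _ => ((), [])) (fun _ => encodeUnary c) () fun p => by
    rw [transduce_stateless]; simp

/-- Polynomials are generated from constants by sums and by multiplication with the variable. -/
theorem polyTime_eval (p : Polynomial ℕ) : PolyTime encodeUnary encodeUnary (fun n => p.eval n) := by
  induction p using Polynomial.induction_on' with
  | add p q hp hq => simpa using polyTime_add.comp (hp.prodMk hq)
  | monomial k c =>
    induction k with
    | zero => simpa using polyTime_const c
    | succ k ih =>
      simpa [pow_succ, mul_assoc] using polyTime_mul.comp (ih.prodMk (polyTime_id encodeUnary))

theorem polyTime_and :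
    PolyTime (encodeProd encodeBool encodeBool) encodeBool (fun p : Bool × Bool => p.1 && p.2) :=
  .of_transduce (fun s x => (s && x.elim id id, [])) (fun s => [s]) true fun p => by
    simp [encodeProd, encodeBool, transduce]

theorem transduce_snd (y : Str) :
    transduce (fun (s : Bool) (x : Option Bool) => (s || x.isNone, if s then x.toList else []))
      (fun _ => []) true (y.map some) = y := by
  induction y with
  | nil => rfl
  | cons b y ih => simpa [transduce] using ih

/-- The state bit records whether the separator has been read. -/
theorem polyTime_snd : PolyTime encodePair id (fun p : Str × Str => p.2) :=
  .of_transduce (fun s x => (s || x.isNone, if s then x.toList else [])) (fun _ => [])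
    false fun p => by
    obtain ⟨x, y⟩ := p
    induction x with
    | nil => simpa [encodePair, transduce] using (transduce_snd y).symm
    | cons b x ih => simpa [encodePair, transduce] using ih

theorem transduce_fst (y : List (Option Bool)) :
    transduce (fun (s : Bool) (x : Option Bool) => (s || x.isNone, if s then [] else x.toList))
      (fun _ => []) true y = [] := by
  induction y with
  | nil => rfl
  | cons b y ih => simpa [transduce] using ih

theorem polyTime_fst : PolyTime encodePair id (fun p : Str × Str => p.1) :=
  .of_transduce (fun s x => (s || x.isNone, if s then [] else x.toList)) (fun _ => [])
    false fun p => by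
    obtain ⟨x, y⟩ := p
    induction x with
    | nil => simpa [encodePair, transduce] using (transduce_fst (y.map some)).symm
    | cons b x ih => simpa [encodePair, transduce] using ih

/-- The separator is emitted just before the first symbol of the second word, or at the very end if
that word is empty. -/
theorem polyTime_encodePair : PolyTime (encodeProd id id) encodePair (fun p : Str × Str => p) :=
  .of_transduce (fun s x => (s || x.isRight,
      x.elim (fun a => [some a]) (fun b => if s then [some b] else [none, some b])))
    (fun s => if s then [] else [none]) false fun p => by
    obtain ⟨x, y⟩ := p
    induction x with
    | nil =>
      cases y with
      | nil => rfl
      | cons c y =>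
        have (y : Str) : transduce (fun (s : Bool) (x : Bool ⊕ Bool) => (s || x.isRight,
            x.elim (fun a => [some a]) (fun b => if s then [some b] else [none, some b])))
            (fun s => if s then [] else [none]) true (y.map .inr) = y.map some := by
          induction y with
          | nil => rfl
          | cons b y ih => simpa [transduce] using ih
        simpa [encodePair, encodeProd, transduce] using (this y).symm
    | cons b x ih => simpa [encodePair, encodeProd, transduce] using ih

theorem PolyTime.pair {α A : Type} [Inhabited A] {ea : α → List A} {f g : α → Str}
    (hf : PolyTime ea id f) (hg : PolyTime ea id g) : PolyTime ea encodePair fun a => (f a, g a) :=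
  polyTime_encodePair.comp (hf.prodMk hg)

theorem FP.tail : FP List.tail :=
  .of_transduce (fun s x => (true, if s then [x] else [])) (fun _ => []) false fun l => by
    have (l : Str) : transduce (fun (s : Bool) (x : Bool) => (true, if s then [x] else []))
        (fun _ => []) true l = l := by
      induction l with
      | nil => rfl
      | cons b l ih => simpa [transduce] using ih
    cases l with
    | nil => rfl
    | cons b l => simpa [transduce] using (this l).symm

theorem FP.cons (c : Bool) : FP (c :: ·) :=
  .of_transduce (fun s x => (true, if s then [x] else [c, x]))
    (fun s => if s then [] else [c]) false fun l => by
    have (l : Str) : transduce (fun (s : Bool) (x : Bool) => (true, if s then [x] else [c, x]))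
        (fun s => if s then [] else [c]) true l = l := by
      induction l with
      | nil => rfl
      | cons b l ih => simpa [transduce] using ih
    cases l with
    | nil => rfl
    | cons b l => simpa [transduce] using (this l).symm

theorem polyTime_some_cons :
    PolyTime (encodeProd encodeBool id) encodePartial
      (fun p : Bool × Str => some (p.1 :: p.2)) :=
  .of_transduce (fun _ x => ((), x.elim (fun a => [true, a]) (fun b => [b]))) (fun _ => []) ()
    fun p => by
      rw [transduce_stateless]
      simp [encodeProd, encodeBool, encodePartial, List.flatMap_map]

theorem P_subset_NP : P ⊆ NP := by
  rintro L ⟨f, hf, hL⟩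
  -- The verifier ignores its certificate, so the bound 0 leaves exactly the empty one.
  refine ⟨fun p => f p.1, 0, hf.comp polyTime_fst, fun x => ?_⟩
  simp [hL]

/-! ### The one-way function -/

/-- The verifier `V`, restricted to certificates of length at most `p |x|`. -/
noncomputable def boundedVerifier (V : Str × Str → Bool) (p : Polynomial ℕ) (x : Str × Str) : Bool :=
  V x && decide (x.2.length ≤ p.eval x.1.length)

theorem polyTime_boundedVerifier {V : Str × Str → Bool} (hV : PolyTime encodePair encodeBool V)
    (p : Polynomial ℕ) : PolyTime encodePair encodeBool (boundedVerifier V p) :=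
  polyTime_and.comp <| hV.prodMk <| polyTime_le.comp <|
    (polyTime_length.comp polyTime_snd).prodMk <|
      (polyTime_eval p).comp (polyTime_length.comp polyTime_fst)

/-- Strings longer than the bound are all rejected, hence interchangeable; the shortest have length
p(|b|) + 1. This is why certificates are truncated: `V` alone need not have short rejected strings.
-/
theorem exists_length_le_boundedVerifier (V : Str × Str → Bool) (p : Polynomial ℕ) (a b : Str) :
    ∃ a' : Str, a'.length ≤ p.eval b.length + 1 ∧
      boundedVerifier V p (b, a') = boundedVerifier V p (b, a) := by
  by_cases h : a.length ≤ p.eval b.length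
  · exact ⟨a, by omega, rfl⟩
  · exact ⟨List.replicate (p.eval b.length + 1) false, by simp, by simp [boundedVerifier, h]⟩

/-- The function that maps `(a, b)` to `b`, prefixed by a bit that tells whether `a` is a
certificate for `b`. -/
noncomputable def certify (V : Str × Str → Bool) (p : Polynomial ℕ) : Fun2 :=
  fun a b => some (boundedVerifier V p (b, a) :: b)

section Certify

variable {V : Str × Str → Bool} {p : Polynomial ℕ}

theorem certify_eq_some {a b z : Str} :
    certify V p a b = some z ↔ boundedVerifier V p (b, a) :: b = z := by
  simp [certify]

theorem total_certify : Total (certify V p) := fun _ _ => ⟨_, rfl⟩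

theorem polyTimeComputable_certify (hV : PolyTime encodePair encodeBool V) :
    PolyTimeComputable (certify V p) :=
  polyTime_some_cons.comp <|
    ((polyTime_boundedVerifier hV p).comp (polyTime_snd.pair polyTime_fst)).prodMk polyTime_snd

/-- A missing second argument is the tail of `z`, so it is shorter than `z`; a missing first
argument can be shortened without changing the verdict. -/
theorem sHonest_certify : SHonest (certify V p) := by
  refine ⟨p + Polynomial.X + 1, ?_, ?_⟩
  · rintro z a ⟨b, hb⟩
    refine ⟨b, ?_, hb⟩
    rw [certify_eq_some] at hb
    subst hb
    simp
    omega
  · rintro z b ⟨a, ha⟩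
    obtain ⟨a', ha', h⟩ := exists_length_le_boundedVerifier V p a b
    rw [certify_eq_some] at ha
    refine ⟨a', ?_, by rw [certify_eq_some, h, ha]⟩
    have := eval_mono_nat p (Nat.le_add_left b.length z.length)
    simp
    omega

theorem honest_certify : Honest (certify V p) := by
  refine ⟨p + Polynomial.X + 1, ?_⟩
  rintro z ⟨a, b, hz⟩
  rw [certify_eq_some] at hz
  obtain ⟨a', ha', h⟩ := exists_length_le_boundedVerifier V p a b
  refine ⟨a', b, ?_, by rw [certify_eq_some, h, hz]⟩
  subst hz
  have := eval_mono_nat p (Nat.le_add_right b.length 1)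
  simp
  omega

/-- An inverter acts as a certificate finder on inputs 1x. Its answer is checked, so garbage
returned when 1x is not in the image does no harm. -/
theorem noninvertible_certify (hV : PolyTime encodePair encodeBool V) {L : Set Str} (hL : L ∉ P)
    (h : ∀ x, x ∈ L ↔ ∃ w : Str, w.length ≤ p.eval x.length ∧ V (x, w) = true) :
    Noninvertible (certify V p) := by
  rintro ⟨g, hg, hinv⟩
  refine hL ⟨fun x => boundedVerifier V p (x, (g (true :: x)).1),
    (polyTime_boundedVerifier hV p).comp <|
      (polyTime_id id).pair (polyTime_fst.comp (hg.comp (FP.cons true))), fun x => ?_⟩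
  constructor
  · intro hx
    obtain ⟨w, hw, hVw⟩ := (h x).1 hx
    have := hinv (true :: x) ⟨w, x, by simp [certify_eq_some, boundedVerifier, hw, hVw]⟩
    rw [certify_eq_some, List.cons.injEq] at this
    obtain ⟨h₁, h₂⟩ := this
    -- The preimage of 1x has second component x, so the bit certifies x itself.
    rw [h₂] at h₁
    exact h₁
  · intro hx
    simp only [boundedVerifier, Bool.and_eq_true, decide_eq_true_eq] at hx
    exact (h x).2 ⟨_, hx.2, hx.1⟩

/-- The second argument can be read off from `z` without looking at `a`. -/
theorem invertibleFst_certify {pair : Str → Str → Str} (hpair : IsPairing pair) :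
    InvertibleFst pair (certify V p) := by
  obtain ⟨π₁, π₂, -, h₂, hπ⟩ := hpair.inverses
  refine ⟨fun x => (π₂ x).tail, FP.tail.comp h₂, ?_⟩
  rintro z - a b hz
  rw [certify_eq_some] at hz
  subst hz
  simp [hπ, certify]

end Certify

end OneWay

theorem corollary3p5 (pair : OneWay.Str → OneWay.Str → OneWay.Str)
    (hpair : OneWay.IsPairing pair) (hPNP : OneWay.P ≠ OneWay.NP) :
    ∃ σ : OneWay.Fun2, OneWay.Total σ ∧ OneWay.SHonest σ ∧ OneWay.IsOneWay σ ∧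
      ¬ OneWay.IsStronglyOneWay pair σ := by
  obtain ⟨L, ⟨V, p, hV, h⟩, hL⟩ : ∃ L ∈ OneWay.NP, L ∉ OneWay.P := by
    by_contra! hsub
    exact hPNP (OneWay.P_subset_NP.antisymm hsub)
  exact ⟨OneWay.certify V p, OneWay.total_certify, OneWay.sHonest_certify,
    ⟨OneWay.honest_certify, OneWay.polyTimeComputable_certify hV,
      OneWay.noninvertible_certify hV hL h⟩,
    fun hs => hs.2.2.1 (OneWay.invertibleFst_certify hpair)⟩
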